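/- Let $K$ be a finite simplicial complex of dimension $n$, let $f_p(K)$ be the number of its $p$-dimensional simplices, and let $\nu\in[0,1]$. Equip the group $\mathcal C^0(K)$ of simplicial $0$-cochains of $K$ with $\mathbb Z/2\mathbb Z$-coefficients with the product probability measure $\mu_\nu$ under which, independently at each vertex, a cochain takes the value $0$ with probability $\nu$ and the value $1$ with probability $1-\nu$. For $\epsilon\in\mathcal C^0(K)$ let $V_\epsilon$ be the subcomplex of the first barycentric subdivision $\mathrm{Sd}(K)$ dual to the coboundary $d\epsilon$: its simplices are the faces of the simplices $[\hat\sigma_0,\dots,\hat\sigma_j]$ of $\mathrm{Sd}(K)$ (where $\sigma_0<\dots<\sigma_j$ are simplices of $K$, each a proper face of the next, and $\hat\sigma$ denotes the barycenter of $\sigma$) such that $\dim\sigma_0=1$ and $\langle d\epsilon,\sigma_0\rangle\neq0$. Let $b_i(\cdot)$ be the $i$-th Betti number with $\mathbb Z/2\mathbb Z$-coefficients, let $\chi(\cdot)=\sum_i(-1)^ib_i(\cdot)$ be the Euler characteristic, and set $$\mathbb E_\nu(b_i)=\int_{\mathcal C^0(K)}b_i(V_\epsilon)\,d\mu_\nu(\epsilon),\qquad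 \mathbb E_\nu(\chi)=\int_{\mathcal C^0(K)}\chi(V_\epsilon)\,d\mu_\nu(\epsilon).$$ Then, for every $i\in\{0,\dots,n-1\}$, $$\mathbb E_\nu(b_i)\le f_{i+1}(K)\bigl(1-\nu^{i+2}-(1-\nu)^{i+2}\bigr),$$ and $$\mathbb E_\nu(\chi)+\chi(K)=\sum_{i=0}^n(-1)^i\bigl(\nu^{i+1}+(1-\nu)^{i+1}\bigr)f_i(K).$$ -/

import Mathlib

open MeasureTheory

namespace RandomSubcomplex

universe u

variable {ι : Type u}

/-- The `p`-dimensional simplices of `K`, i.e. its faces with `p + 1` vertices. -/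
def Simplex (K : PreAbstractSimplicialComplex ι) (p : ℕ) : Type u :=
  {σ : Finset ι // σ ∈ K.faces ∧ σ.card = p + 1}

instance (K : PreAbstractSimplicialComplex ι) (p : ℕ) [Finite K.faces] :
    Finite (Simplex K p) :=
  Finite.of_injective (fun σ => (⟨σ.1, σ.2.1⟩ : K.faces)) fun _ _ h =>
    Subtype.ext (congrArg (fun x : K.faces => x.1) h)

/-- The number `f_p(K)` of `p`-dimensional simplices of `K`. -/
noncomputable def faceNumber (K : PreAbstractSimplicialComplex ι) (p : ℕ) : ℕ :=
  Nat.card (Simplex K p)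

/-- `K` has dimension `n`: `n` is the maximum of the dimensions of its simplices. -/
def HasDimension (K : PreAbstractSimplicialComplex ι) (n : ℕ) : Prop :=
  Nonempty (Simplex K n) ∧ ∀ σ ∈ K.faces, σ.card ≤ n + 1

open Classical in
/-- The facet (codimension one face) of a `(p + 1)`-simplex opposite to one of its vertices. -/
noncomputable def Simplex.facet {K : PreAbstractSimplicialComplex ι} {p : ℕ}
    (τ : Simplex K (p + 1)) (v : {v // v ∈ τ.1}) : Simplex K p :=
  ⟨τ.1.erase v.1, by
    have hcard : (τ.1.erase v.1).card = p + 1 := by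
      rw [Finset.card_erase_of_mem v.2, τ.2.2]; rfl
    exact ⟨(K.isRelLowerSet_faces τ.2.1).2 (Finset.erase_subset _ _)
      (Finset.card_pos.mp (by omega)), hcard⟩⟩

/-! Simplicial homology with `ℤ/2ℤ` coefficients. -/

/-- Simplicial `p`-chains with `ℤ/2ℤ` coefficients. -/
abbrev Chain (K : PreAbstractSimplicialComplex ι) (p : ℕ) : Type u :=
  Simplex K p →₀ ZMod 2

/-- The boundary operator `∂ : C_{p+1}(K) → C_p(K)`: a simplex is sent to the sum of its facets. -/
noncomputable def boundary (K : PreAbstractSimplicialComplex ι) (p : ℕ) :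
    Chain K (p + 1) →ₗ[ZMod 2] Chain K p :=
  Finsupp.linearCombination (ZMod 2)
    fun τ : Simplex K (p + 1) => ∑ v ∈ τ.1.attach, Finsupp.single (τ.facet v) (1 : ZMod 2)

/-- The `p`-cycles; every `0`-chain is a cycle. -/
noncomputable def cycles (K : PreAbstractSimplicialComplex ι) :
    (p : ℕ) → Submodule (ZMod 2) (Chain K p)
  | 0 => ⊤
  | p + 1 => LinearMap.ker (boundary K p)

/-- The `p`-boundaries. -/
noncomputable def boundaries (K : PreAbstractSimplicialComplex ι) (p : ℕ) :
    Submodule (ZMod 2) (Chain K p) :=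
  LinearMap.range (boundary K p)

noncomputable instance (K : PreAbstractSimplicialComplex ι) (p : ℕ) :
    AddCommGroup (cycles K p) :=
  Submodule.addCommGroup (cycles K p)

/-- The simplicial homology group `H_p(K; ℤ/2ℤ)`, cycles modulo boundaries. -/
abbrev Homology (K : PreAbstractSimplicialComplex ι) (p : ℕ) : Type u :=
  cycles K p ⧸ (boundaries K p).submoduleOf (cycles K p)

/-- The Betti number `b_p(K) = dim H_p(K; ℤ/2ℤ)`. -/
noncomputable def betti (K : PreAbstractSimplicialComplex ι) (p : ℕ) : ℕ :=
  Module.finrank (ZMod 2) (Homology K p)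

/-- The Euler characteristic `χ(K) = ∑_i (-1)^i b_i(K)` (a finite sum when `K` is finite). -/
noncomputable def eulerChar (K : PreAbstractSimplicialComplex ι) : ℤ :=
  ∑ᶠ i : ℕ, (-1 : ℤ) ^ i * (betti K i : ℤ)

/-! Cochains, the barycentric subdivision and the dual subcomplexes. -/

/-- Simplicial `p`-cochains with `ℤ/2ℤ` coefficients. -/
abbrev Cochain (K : PreAbstractSimplicialComplex ι) (p : ℕ) : Type u :=
  Simplex K p → ZMod 2

/-- The coboundary `d : C^p(K) → C^{p+1}(K)`; `⟨dε, τ⟩` is the sum of `ε` on the facets of `τ`. -/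
noncomputable def coboundary {K : PreAbstractSimplicialComplex ι} {p : ℕ}
    (ε : Cochain K p) : Cochain K (p + 1) :=
  fun τ => ∑ v ∈ τ.1.attach, ε (τ.facet v)

/-- The first barycentric subdivision `Sd(K)`. A simplex `σ` of `K` stands for its barycenter,
and the simplices of `Sd(K)` are the nonempty finite sets of simplices of `K` which are totally
ordered by inclusion. -/
def barycentricSubdivision (K : PreAbstractSimplicialComplex ι) :
    PreAbstractSimplicialComplex (Finset ι) where
  faces := {c | c.Nonempty ∧ (∀ σ ∈ c, σ ∈ K.faces) ∧
    IsChain (fun σ τ : Finset ι => σ ⊆ τ) (c : Set (Finset ι))}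
  isRelLowerSet_faces := fun _ hc =>
    ⟨hc.1, fun _ hbc hb => ⟨hb, fun σ hσ => hc.2.1 σ (hbc hσ),
      fun _ hx _ hy hxy => hc.2.2 (hbc hx) (hbc hy) hxy⟩⟩

/-- The subcomplex `V_ε` of `Sd(K)` dual to the cocycle `dε`, for `ε ∈ C^{k-1}(K)` with
`k = p + 1`: its simplices are the nonempty faces of the simplices `[σ₀, …, σᵢ]` of `Sd(K)`,
`σ₀ < … < σᵢ`, such that `dim σ₀ = k` and `⟨dε, σ₀⟩ ≠ 0`. -/
def dualSubcomplex {K : PreAbstractSimplicialComplex ι} {p : ℕ} (ε : Cochain K p) :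
    PreAbstractSimplicialComplex (Finset ι) where
  faces := {s | s.Nonempty ∧ ∃ c ∈ (barycentricSubdivision K).faces, s ⊆ c ∧
    ∃ σ₀ : Simplex K (p + 1), σ₀.1 ∈ c ∧ (∀ σ ∈ c, σ₀.1 ⊆ σ) ∧ coboundary ε σ₀ ≠ 0}
  isRelLowerSet_faces := fun _ hs =>
    ⟨hs.1, fun _ hbs hb => by
      obtain ⟨_, c, hc, hsc, hσ⟩ := hs
      exact ⟨hb, c, hc, Finset.Subset.trans hbs hsc, hσ⟩⟩

/-! The random cochain. -/

/-- The probability measure on `ℤ/2ℤ` giving mass `ν` to `0` and `1 - ν` to `1`. -/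
noncomputable def bernoulliLaw (ν : ℝ) : Measure (ZMod 2) :=
  ENNReal.ofReal ν • Measure.dirac 0 + ENNReal.ofReal (1 - ν) • Measure.dirac 1

open Classical in
/-- The product probability measure `μ_ν` on `C^p(K)`, for finite `K`: independently on each
`p`-simplex the cochain is `0` with probability `ν` and `1` with probability `1 - ν`. -/
noncomputable def cochainLaw (K : PreAbstractSimplicialComplex ι) [Finite K.faces] (p : ℕ)
    (ν : ℝ) : Measure (Cochain K p) :=
  letI : Fintype (Simplex K p) := Fintype.ofFinite _
  Measure.pi fun _ => bernoulliLaw ν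

/-- The expected value `𝔼_ν(b_i)` of the `i`-th Betti number of `V_ε` for `ε ∈ C^p(K)`. -/
noncomputable def expectedBetti (K : PreAbstractSimplicialComplex ι) [Finite K.faces] (p : ℕ)
    (ν : ℝ) (i : ℕ) : ℝ :=
  ∫ ε : Cochain K p, (betti (dualSubcomplex ε) i : ℝ) ∂(cochainLaw K p ν)

/-- The expected value `𝔼_ν(χ)` of the Euler characteristic of `V_ε` for `ε ∈ C^p(K)`. -/
noncomputable def expectedEulerChar (K : PreAbstractSimplicialComplex ι) [Finite K.faces] (p : ℕ)
    (ν : ℝ) : ℝ :=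
  ∫ ε : Cochain K p, (eulerChar (dualSubcomplex ε) : ℝ) ∂(cochainLaw K p ν)

end RandomSubcomplex

/-! A 0-cochain has nonzero coboundary on an edge exactly when it is nonconstant there, so `V_ε` is
the order complex of the poset `Q` of faces of `K` on which `ε` is nonconstant. `Q` can be built by
adding faces in order of increasing cardinality. Adding `p` cones off its link, the order complex of
the proper nonconstant subsets of `p`, which has the homology of a sphere of dimension `|p| - 3`
(`sphere_nonconstantSSubsets`). Each face of dimension `i + 1` in `Q` thus acts as a cell of
dimension `i`: it adds at most one to `b_i`, and exactly `(-1)^i` to `χ`. Hence `b_i(V_ε)` is at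
most the number of `(i + 1)`-faces in `Q`, and `χ(V_ε)` is the sum of `(-1)^|σ|` over `Q`
(`dualSubcomplex_bounds`).

By independence a face with `k` vertices is nonconstant with probability `1 - ν^k - (1 - ν)^k`.
Linearity of expectation gives both claims; adding `χ(K)` cancels the constant 1 in these
probabilities.

Homology enters only through ranks of incidence matrices. Deleting a vertex makes such a matrix
block triangular, and superadditivity of rank then replaces the long exact sequence
(`rankDefect_le_deletion_add_link`). Only upper bounds on homology are needed. -/

namespace Matrix

/-! ### Superadditivity of rank for block triangular matrices -/

variable {F m m₁ m₂ n n₁ n₂ : Type*} [Field F]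

/-- Project the column space to the lower block: the image contains the column space of `D`, and the
kernel contains a copy of that of `B`. -/
theorem rank_add_rank_le_rank_fromBlocks [Finite m₁] [Finite m₂] [Fintype n₁] [Fintype n₂]
    (B : Matrix m₁ n₁ F) (C : Matrix m₁ n₂ F) (D : Matrix m₂ n₂ F) :
    B.rank + D.rank ≤ (fromBlocks B C 0 D).rank := by
  have := Fintype.ofFinite m₁
  have := Fintype.ofFinite m₂
  set R := LinearMap.range (fromBlocks B C 0 D).mulVecLin with hR
  let g : R →ₗ[F] (m₂ → F) := (LinearMap.funLeft F F Sum.inr) ∘ₗ R.subtype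
  have h := g.finrank_range_add_finrank_ker
  have h1 : D.rank ≤ Module.finrank F (LinearMap.range g) := by
    refine Submodule.finrank_mono ?_
    rintro _ ⟨y, rfl⟩
    refine ⟨⟨_, Sum.elim 0 y, rfl⟩, ?_⟩
    ext i
    simp [g, LinearMap.funLeft, fromBlocks_mulVec]
  have h2 : B.rank ≤ Module.finrank F (LinearMap.ker g) := by
    let l : LinearMap.ker g →ₗ[F] (m₁ → F) :=
      (LinearMap.funLeft F F Sum.inl) ∘ₗ R.subtype ∘ₗ (LinearMap.ker g).subtype
    refine le_trans (Submodule.finrank_mono ?_) (LinearMap.finrank_range_le l)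
    rintro _ ⟨x, rfl⟩
    refine ⟨⟨⟨_, Sum.elim x 0, rfl⟩, ?_⟩, ?_⟩
    · ext i
      simp [g, LinearMap.funLeft, fromBlocks_mulVec]
    · ext i
      simp [l, LinearMap.funLeft, fromBlocks_mulVec]
  change B.rank + D.rank ≤ Module.finrank F R
  omega

theorem rank_submatrix_add_rank_submatrix_le [Finite m] [Finite m₁] [Finite m₂] [Fintype n]
    [Fintype n₁] [Fintype n₂] (A : Matrix m n F) (r₁ : m₁ → m) (r₂ : m₂ → m) (c₁ : n₁ → n)
    (c₂ : n₂ → n) (h : ∀ i j, A (r₂ i) (c₁ j) = 0) :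
    (A.submatrix r₁ c₁).rank + (A.submatrix r₂ c₂).rank ≤ A.rank := by
  have hA : A.submatrix (Sum.elim r₁ r₂) (Sum.elim c₁ c₂) =
      fromBlocks (A.submatrix r₁ c₁) (A.submatrix r₁ c₂) 0 (A.submatrix r₂ c₂) := by
    ext (i | i) (j | j) <;> simp [h]
  exact (rank_add_rank_le_rank_fromBlocks _ (A.submatrix r₁ c₂) _).trans
    (hA ▸ rank_submatrix_le A _ _)

end Matrix

namespace RandomSubcomplex

/-! ### Deletion, link and homology ranks of families of finite sets -/

section FinsetFamilies

variable {α : Type*}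

/-- The members of a family of finite sets with `d` elements. -/
def cardSlice (L : Finset (Finset α)) (d : ℤ) : Finset (Finset α) :=
  L.filter fun s => (s.card : ℤ) = d

@[simp]
theorem mem_cardSlice {L : Finset (Finset α)} {d : ℤ} {s : Finset α} :
    s ∈ cardSlice L d ↔ s ∈ L ∧ (s.card : ℤ) = d := Finset.mem_filter

variable [DecidableEq α]

/-- The matrix of the boundary operator from the sets of `L` with `d` elements to those with
`d - 1` elements. -/
def incidence (L : Finset (Finset α)) (d : ℤ) :
    Matrix (cardSlice L (d - 1)) (cardSlice L d) (ZMod 2) :=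
  Matrix.of fun s t => if s.1 ⊆ t.1 then 1 else 0

/-- The dimension of the homology of the family `L` at the sets with `d` elements, as the number
of these sets minus the ranks of the two adjacent boundary operators. -/
noncomputable def rankDefect (L : Finset (Finset α)) (d : ℤ) : ℤ :=
  (cardSlice L d).card - (incidence L d).rank - (incidence L (d + 1)).rank

/-- The sum of the signs `(-1) ^ |s|` over the family `L`. -/
def signSum (L : Finset (Finset α)) : ℤ := ∑ s ∈ L, (-1) ^ s.card

/-- The members of `L` which avoid `p`. -/
def deletion (L : Finset (Finset α)) (p : α) : Finset (Finset α) := L.filter fun s => p ∉ s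

/-- The members of `L` which contain `p`, with `p` removed. -/
def link (L : Finset (Finset α)) (p : α) : Finset (Finset α) :=
  (L.filter fun s => p ∈ s).image fun s => s.erase p

@[simp]
theorem mem_deletion {L : Finset (Finset α)} {p : α} {s : Finset α} :
    s ∈ deletion L p ↔ s ∈ L ∧ p ∉ s := Finset.mem_filter

@[simp]
theorem mem_link {L : Finset (Finset α)} {p : α} {s : Finset α} :
    s ∈ link L p ↔ insert p s ∈ L ∧ p ∉ s := by
  simp only [link, Finset.mem_image, Finset.mem_filter]
  constructor
  · rintro ⟨t, ⟨ht, hp⟩, rfl⟩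
    simpa [Finset.insert_erase hp] using ht
  · rintro ⟨h, hp⟩
    exact ⟨insert p s, ⟨h, by simp⟩, Finset.erase_insert hp⟩

theorem sum_link (L : Finset (Finset α)) (p : α) {M : Type*} [AddCommMonoid M]
    (f : Finset α → M) :
    ∑ s ∈ link L p, f (insert p s) = ∑ s ∈ L.filter (fun s => p ∈ s), f s := by
  refine Finset.sum_bij' (fun s _ => insert p s) (fun s _ => s.erase p) ?_ ?_ ?_ ?_ ?_
  · intro s hs
    simpa using (mem_link.1 hs).1
  · intro s hs
    have := Finset.mem_filter.1 hs
    simpa [Finset.insert_erase this.2] using this.1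
  · intro s hs
    exact Finset.erase_insert (mem_link.1 hs).2
  · intro s hs
    exact Finset.insert_erase (Finset.mem_filter.1 hs).2
  · intro s hs
    rfl

theorem signSum_eq_deletion_sub_link (L : Finset (Finset α)) (p : α) :
    signSum L = signSum (deletion L p) - signSum (link L p) := by
  have h : ∑ s ∈ link L p, (-1 : ℤ) ^ (insert p s).card = - signSum (link L p) := by
    rw [signSum, ← Finset.sum_neg_distrib]
    refine Finset.sum_congr rfl fun s hs => ?_
    rw [Finset.card_insert_of_notMem (mem_link.1 hs).2, pow_succ, mul_neg_one]
  rw [sub_eq_add_neg, ← h, sum_link L p fun s => (-1 : ℤ) ^ s.card, add_comm]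
  exact (Finset.sum_filter_add_sum_filter_not L (fun s => p ∈ s) _).symm

theorem cardSlice_card_eq (L : Finset (Finset α)) (p : α) (d : ℤ) :
    (cardSlice L d).card = (cardSlice (deletion L p) d).card +
      (cardSlice (link L p) (d - 1)).card := by
  have h := sum_link L p fun s => if (s.card : ℤ) = d then 1 else 0
  have h' : ∑ s ∈ link L p, (if ((insert p s).card : ℤ) = d then 1 else 0) =
      ∑ s ∈ link L p, if (s.card : ℤ) = d - 1 then 1 else 0 := by
    refine Finset.sum_congr rfl fun s hs => ?_
    rw [Finset.card_insert_of_notMem (mem_link.1 hs).2]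
    push_cast
    simp only [eq_sub_iff_add_eq]
  simp only [cardSlice, Finset.card_filter]
  rw [← h', h, add_comm]
  exact (Finset.sum_filter_add_sum_filter_not L (fun s => p ∈ s) _).symm

/-- The sets of `L` avoiding `p`, inside `L`. -/
def ofDeletion {L : Finset (Finset α)} {p : α} {d : ℤ} (s : cardSlice (deletion L p) d) :
    cardSlice L d :=
  ⟨s.1, by
    have := mem_cardSlice.1 s.2
    exact mem_cardSlice.2 ⟨(mem_deletion.1 this.1).1, this.2⟩⟩

/-- The sets of the link of `p`, with `p` added. -/
def ofLink {L : Finset (Finset α)} {p : α} {d e : ℤ} (h : e = d + 1)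
    (s : cardSlice (link L p) d) : cardSlice L e :=
  ⟨insert p s.1, by
    have hs := mem_cardSlice.1 s.2
    have hs' := mem_link.1 hs.1
    refine mem_cardSlice.2 ⟨hs'.1, ?_⟩
    rw [Finset.card_insert_of_notMem hs'.2]
    push_cast
    rw [hs.2, h]⟩

theorem notMem_of_deletion {L : Finset (Finset α)} {p : α} {d : ℤ}
    (s : cardSlice (deletion L p) d) : p ∉ s.1 :=
  (mem_deletion.1 (mem_cardSlice.1 s.2).1).2

theorem notMem_of_link {L : Finset (Finset α)} {p : α} {d : ℤ}
    (s : cardSlice (link L p) d) : p ∉ s.1 :=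
  (mem_link.1 (mem_cardSlice.1 s.2).1).2

/-- A set containing `p` is never inside a set avoiding `p`, so sorting by membership of `p` makes
the matrix block triangular, with the matrices of the deletion and the link on the diagonal. -/
theorem rank_incidence_deletion_add_link_le (L : Finset (Finset α)) (p : α) (d : ℤ) :
    (incidence (deletion L p) d).rank + (incidence (link L p) (d - 1)).rank ≤
      (incidence L d).rank := by
  refine le_trans (le_of_eq ?_) (Matrix.rank_submatrix_add_rank_submatrix_le (incidence L d)
    (ofDeletion (L := L) (p := p)) (ofLink (L := L) (p := p) (d := d - 1 - 1) (by ring))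
    (ofDeletion (L := L) (p := p)) (ofLink (L := L) (p := p) (d := d - 1) (by ring)) ?_)
  · congr 2
    ext s t
    simp [incidence, ofLink, Finset.insert_subset_insert_iff (notMem_of_link s)]
  · intro s t
    simp only [incidence, ofLink, ofDeletion, Matrix.of_apply, ite_eq_right_iff]
    intro h
    exact absurd (h (Finset.mem_insert_self _ _)) (notMem_of_deletion t)

theorem rankDefect_le_deletion_add_link (L : Finset (Finset α)) (p : α) (d : ℤ) :
    rankDefect L d ≤ rankDefect (deletion L p) d + rankDefect (link L p) (d - 1) := by
  have h1 := rank_incidence_deletion_add_link_le L p d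
  have h2 := rank_incidence_deletion_add_link_le L p (d + 1)
  have h3 := cardSlice_card_eq L p d
  have h4 : (incidence (link L p) (d + 1 - 1)).rank = (incidence (link L p) (d - 1 + 1)).rank := by
    rw [show d + 1 - 1 = d - 1 + 1 by ring]
  simp only [rankDefect]
  omega

/-- Vanishing of the homology and of the Euler characteristic of a family of finite sets. -/
def IsAcyclicFamily (L : Finset (Finset α)) : Prop :=
  (∀ d, rankDefect L d ≤ 0) ∧ signSum L = 0

theorem IsAcyclicFamily.of_deletion_link {L : Finset (Finset α)} {p : α}
    (h₁ : IsAcyclicFamily (deletion L p)) (h₂ : IsAcyclicFamily (link L p)) :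
    IsAcyclicFamily L := by
  refine ⟨fun d => ?_, ?_⟩
  · linarith [rankDefect_le_deletion_add_link L p d, h₁.1 d, h₂.1 (d - 1)]
  · rw [signSum_eq_deletion_sub_link L p, h₁.2, h₂.2, sub_zero]

/-- In a cone with apex `q`, the rows `s` avoiding `q` and the columns `insert q s` form an identity
matrix. -/
theorem card_deletion_le_rank {L : Finset (Finset α)} {q : α} (h : link L q = deletion L q)
    (d : ℤ) : (cardSlice (deletion L q) (d - 1)).card ≤ (incidence L d).rank := by
  have hmem : ∀ s : cardSlice (deletion L q) (d - 1), s.1 ∈ cardSlice (link L q) (d - 1) :=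
    fun s => by rw [h]; exact s.2
  have key := Matrix.rank_submatrix_le (incidence L d) (ofDeletion (L := L) (p := q))
    (fun s => ofLink (L := L) (p := q) (e := d) (by ring) ⟨s.1, hmem s⟩)
  have h1 : (incidence L d).submatrix (ofDeletion (L := L) (p := q))
      (fun s => ofLink (L := L) (p := q) (e := d) (by ring) ⟨s.1, hmem s⟩) = 1 := by
    ext s t
    simp only [incidence, ofLink, ofDeletion, Matrix.submatrix_apply, Matrix.of_apply,
      Matrix.one_apply]
    refine if_congr ?_ rfl rfl
    rw [Finset.subset_insert_iff_of_notMem (notMem_of_deletion s), Subtype.ext_iff]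
    refine ⟨fun hst => Finset.eq_of_subset_of_card_le hst ?_, fun hst => hst ▸ subset_rfl⟩
    have hs := (mem_cardSlice.1 s.2).2
    have ht := (mem_cardSlice.1 t.2).2
    omega
  rw [h1, Matrix.rank_one, Fintype.card_coe] at key
  exact key

/-- If `a_d` counts the `d`-element sets avoiding the apex, there are `a_d + a_{d-1}` sets with `d`
elements, and the two adjacent ranks are at least `a_{d-1}` and `a_d`. -/
theorem IsAcyclicFamily.of_cone {L : Finset (Finset α)} {q : α}
    (h : link L q = deletion L q) : IsAcyclicFamily L := by
  refine ⟨fun d => ?_, ?_⟩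
  · have h1 := card_deletion_le_rank h d
    have h2 := card_deletion_le_rank h (d + 1)
    have h3 := cardSlice_card_eq L q d
    rw [h] at h3
    have h4 : (cardSlice (deletion L q) (d + 1 - 1)).card = (cardSlice (deletion L q) d).card := by
      rw [add_sub_cancel_right]
    simp only [rankDefect]
    omega
  · rw [signSum_eq_deletion_sub_link L q, h, sub_self]

end FinsetFamilies

end RandomSubcomplex

namespace RandomSubcomplex

/-! ### Order complexes and closure operators -/

section ChainFamilies

variable {α : Type*}

open Classical in
/-- The chains of the relation `r` contained in `Q`, including the empty one. -/
noncomputable def chainFamily (r : α → α → Prop) (Q : Finset α) : Finset (Finset α) :=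
  Q.powerset.filter fun s => IsChain r (s : Set α)

@[simp]
theorem mem_chainFamily {r : α → α → Prop} {Q s : Finset α} :
    s ∈ chainFamily r Q ↔ s ⊆ Q ∧ IsChain r (s : Set α) := by
  simp [chainFamily]

theorem chainFamily_flip (r : α → α → Prop) (Q : Finset α) :
    chainFamily (flip r) Q = chainFamily r Q := by
  ext s
  simp only [mem_chainFamily]
  exact and_congr_right fun _ => ⟨fun h => h.symm, fun h => h.symm⟩

variable [DecidableEq α]

theorem deletion_chainFamily (r : α → α → Prop) (Q : Finset α) (p : α) :
    deletion (chainFamily r Q) p = chainFamily r (Q.erase p) := by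
  ext s
  simp only [mem_deletion, mem_chainFamily, Finset.subset_erase]
  tauto

open Classical in
/-- The elements of `Q` other than `p` which are comparable to `p`. -/
noncomputable def comparables (r : α → α → Prop) (Q : Finset α) (p : α) : Finset α :=
  Q.filter fun x => x ≠ p ∧ (r x p ∨ r p x)

@[simp]
theorem mem_comparables {r : α → α → Prop} {Q : Finset α} {p x : α} :
    x ∈ comparables r Q p ↔ x ∈ Q ∧ x ≠ p ∧ (r x p ∨ r p x) := by
  simp [comparables]

theorem insert_mem_chainFamily_iff {r : α → α → Prop} {Q s : Finset α} {p : α} (hp : p ∈ Q)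
    (hs : p ∉ s) :
    insert p s ∈ chainFamily r Q ↔ s ∈ chainFamily r (comparables r Q p) := by
  simp only [mem_chainFamily, Finset.coe_insert]
  constructor
  · rintro ⟨h1, h2⟩
    refine ⟨fun x hx => mem_comparables.2 ⟨h1 (Finset.mem_insert_of_mem hx), ?_, ?_⟩,
      h2.mono (Set.subset_insert _ _)⟩
    · rintro rfl
      exact hs hx
    · refine h2 (Set.mem_insert_of_mem _ hx) (Set.mem_insert _ _) ?_
      rintro rfl
      exact hs hx
  · rintro ⟨h1, h2⟩
    refine ⟨Finset.insert_subset hp fun x hx => (mem_comparables.1 (h1 hx)).1,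
      h2.insert fun x hx _ => (mem_comparables.1 (h1 hx)).2.2.symm⟩

theorem link_chainFamily {r : α → α → Prop} {Q : Finset α} {p : α} (hp : p ∈ Q) :
    link (chainFamily r Q) p = chainFamily r (comparables r Q p) := by
  ext s
  rw [mem_link]
  constructor
  · rintro ⟨h, hs⟩
    exact (insert_mem_chainFamily_iff hp hs).1 h
  · intro h
    have hs : p ∉ s := fun hs => (mem_comparables.1 ((mem_chainFamily.1 h).1 hs)).2.1 rfl
    exact ⟨(insert_mem_chainFamily_iff hp hs).2 h, hs⟩

theorem isAcyclicFamily_chainFamily_of_cone {r : α → α → Prop} {Q : Finset α} {q : α}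
    (hq : q ∈ Q) (h : ∀ x ∈ Q, x ≠ q → r x q ∨ r q x) :
    IsAcyclicFamily (chainFamily r Q) := by
  refine IsAcyclicFamily.of_cone (q := q) ?_
  rw [link_chainFamily hq, deletion_chainFamily]
  congr 1
  ext x
  simp only [mem_comparables, Finset.mem_erase]
  exact ⟨fun hx => ⟨hx.2.1, hx.1⟩, fun hx => ⟨hx.2, hx.1, h x hx.2 hx.1⟩⟩

/-- A family of chains is acyclic as soon as the chains of fixed points of a closure operator
are. The relation is only required to increase a given rank function. -/
theorem isAcyclicFamily_chainFamily_of_closure {r : α → α → Prop}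
    (htrans : ∀ x y z, r x y → r y z → r x z) (m : α → ℕ) (f : α → α) (Q : Finset α)
    (hm : ∀ x ∈ Q, ∀ y ∈ Q, r x y → x ≠ y → m x < m y)
    (hfQ : ∀ x ∈ Q, f x ∈ Q) (hff : ∀ x ∈ Q, f (f x) = f x) (hf : ∀ x ∈ Q, r x (f x))
    (hmono : ∀ x ∈ Q, ∀ y ∈ Q, r x y → r (f x) (f y))
    (hfix : IsAcyclicFamily (chainFamily r (Q.filter fun x => f x = x))) :
    IsAcyclicFamily (chainFamily r Q) := by
  induction Q using Finset.strongInduction with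
  | H Q ih =>
    by_cases hall : ∀ x ∈ Q, f x = x
    · rwa [Finset.filter_true_of_mem hall] at hfix
    · push Not at hall
      obtain ⟨x₀, hx₀, hx₀'⟩ := hall
      obtain ⟨p, hp, hmax⟩ := Finset.exists_max_image (Q.filter fun x => f x ≠ x) m
        ⟨x₀, Finset.mem_filter.2 ⟨hx₀, hx₀'⟩⟩
      obtain ⟨hpQ, hpf⟩ := Finset.mem_filter.1 hp
      have hmem : ∀ x ∈ Q.erase p, x ∈ Q := fun x hx => Finset.mem_of_mem_erase hx
      refine IsAcyclicFamily.of_deletion_link (p := p) ?_ ?_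
      · rw [deletion_chainFamily]
        refine ih _ (Finset.erase_ssubset hpQ)
          (fun x hx y hy => hm x (hmem x hx) y (hmem y hy))
          (fun x hx => Finset.mem_erase.2 ⟨?_, hfQ x (hmem x hx)⟩)
          (fun x hx => hff x (hmem x hx)) (fun x hx => hf x (hmem x hx))
          (fun x hx y hy => hmono x (hmem x hx) y (hmem y hy)) ?_
        -- The point `p` is not fixed, while every value of `f` is, so `f` never takes the value
        -- `p`.
        · intro h
          have := hff x (hmem x hx)
          rw [h] at this
          exact hpf this
        · convert hfix using 2
          ext x
          simp only [Finset.mem_filter, Finset.mem_erase]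
          refine ⟨fun h => ⟨h.1.2, h.2⟩, fun h => ⟨⟨?_, h.1⟩, h.2⟩⟩
          rintro rfl
          exact hpf h.2
      · rw [link_chainFamily hpQ]
        -- The link of `p` is a cone with apex `f p`: points before `p` precede `f p`, and points
        -- `x` after `p` have larger `m`, hence are fixed by the choice of `p`, so that `f p`
        -- precedes `f x = x`.
        refine isAcyclicFamily_chainFamily_of_cone (q := f p)
          (mem_comparables.2 ⟨hfQ p hpQ, hpf, Or.inr (hf p hpQ)⟩) fun x hx _ => ?_
        obtain ⟨hxQ, hxp, h | h⟩ := mem_comparables.1 hx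
        · exact Or.inl (htrans _ _ _ h (hf p hpQ))
        · have hfx : f x = x := by
            by_contra hne
            exact absurd (hm p hpQ x hxQ h hxp.symm)
              (not_lt.2 (hmax x (Finset.mem_filter.2 ⟨hxQ, hne⟩)))
          have := hmono p hpQ x hxQ h
          rw [hfx] at this
          exact Or.inr this

end ChainFamilies

/-! ### Posets of nonconstant sets -/

section Nonconstant

variable {ι : Type*}

/-- The function `e` takes at least two values on `σ`. -/
def IsNonconstantOn (e : ι → ZMod 2) (σ : Finset ι) : Prop := ∃ x ∈ σ, ∃ y ∈ σ, e x ≠ e y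

theorem IsNonconstantOn.mono {e : ι → ZMod 2} {σ τ : Finset ι} (h : IsNonconstantOn e σ)
    (hστ : σ ⊆ τ) : IsNonconstantOn e τ := by
  obtain ⟨x, hx, y, hy, hxy⟩ := h
  exact ⟨x, hστ hx, y, hστ hy, hxy⟩

theorem IsNonconstantOn.exists_ne {e : ι → ZMod 2} {σ : Finset ι} (h : IsNonconstantOn e σ)
    (c : ZMod 2) : ∃ x ∈ σ, e x ≠ c := by
  obtain ⟨x, hx, y, hy, hxy⟩ := h
  by_cases hc : e x = c
  · exact ⟨y, hy, fun hy' => hxy (hc.trans hy'.symm)⟩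
  · exact ⟨x, hx, hc⟩

theorem IsNonconstantOn.exists_eq {e : ι → ZMod 2} {σ : Finset ι} (h : IsNonconstantOn e σ)
    (c : ZMod 2) : ∃ x ∈ σ, e x = c := by
  obtain ⟨x, hx, y, hy, hxy⟩ := h
  have key : ∀ a b c : ZMod 2, a ≠ b → a = c ∨ b = c := by decide
  rcases key _ _ c hxy with h | h
  exacts [⟨x, hx, h⟩, ⟨y, hy, h⟩]

theorem IsNonconstantOn.two_le_card {e : ι → ZMod 2} {σ : Finset ι} (h : IsNonconstantOn e σ) :
    2 ≤ σ.card := by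
  obtain ⟨x, hx, y, hy, hxy⟩ := h
  exact Finset.one_lt_card.2 ⟨x, hx, y, hy, fun h => hxy (h ▸ rfl)⟩

variable [DecidableEq ι]

open Classical in
/-- The proper subsets of `σ` on which `e` is not constant. -/
noncomputable def nonconstantSSubsets (e : ι → ZMod 2) (σ : Finset ι) : Finset (Finset ι) :=
  σ.ssubsets.filter fun ρ => IsNonconstantOn e ρ

@[simp]
theorem mem_nonconstantSSubsets {e : ι → ZMod 2} {σ ρ : Finset ι} :
    ρ ∈ nonconstantSSubsets e σ ↔ ρ ⊂ σ ∧ IsNonconstantOn e ρ := by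
  simp [nonconstantSSubsets]

/-- Two retractions followed by a cone. Adding `v` retracts onto the sets containing `v`; discarding
from these the other elements with the value `e v` retracts onto a poset with a largest element. -/
theorem isAcyclicFamily_nonconstantSSubsets_erase {e : ι → ZMod 2} {σ : Finset ι} {v : ι}
    (hv : v ∈ σ) (hτ : IsNonconstantOn e (σ.erase v)) :
    IsAcyclicFamily (chainFamily (· ⊆ ·) ((nonconstantSSubsets e σ).erase (σ.erase v))) := by
  have hmem : ∀ ρ : Finset ι, ρ ∈ (nonconstantSSubsets e σ).erase (σ.erase v) ↔
      ρ ≠ σ.erase v ∧ ρ ⊂ σ ∧ IsNonconstantOn e ρ := by simp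
  refine isAcyclicFamily_chainFamily_of_closure (fun _ _ _ h h' => h.trans h') Finset.card
    (insert v) _ (fun x _ y _ h hne => Finset.card_lt_card (h.ssubset_of_ne hne)) ?_ ?_ ?_ ?_ ?_
  · intro ρ hρ
    obtain ⟨h1, h2, h3⟩ := (hmem ρ).1 hρ
    refine (hmem _).2 ⟨fun h => ?_, (Finset.insert_subset hv h2.1).ssubset_of_ne fun h => ?_,
      h3.mono (Finset.subset_insert _ _)⟩
    -- Adding `v` stays in the poset: only `σ` and `σ.erase v` would be sent to `σ`, and both are
    -- excluded.
    · have := Finset.mem_insert_self v ρ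
      rw [h] at this
      simp at this
    · by_cases hvρ : v ∈ ρ
      · rw [Finset.insert_eq_of_mem hvρ] at h
        exact h2.ne h
      · exact h1 (by rw [← h, Finset.erase_insert hvρ])
  · intro ρ _
    simp
  · intro ρ _
    exact Finset.subset_insert _ _
  · intro x _ y _ h
    exact Finset.insert_subset_insert _ h
  -- The second operator shrinks sets, so it is a closure operator for reverse inclusion.
  rw [← chainFamily_flip]
  set Q := (((nonconstantSSubsets e σ).erase (σ.erase v)).filter fun ρ => insert v ρ = ρ)
    with hQ
  have hmemQ : ∀ ρ : Finset ι, ρ ∈ Q ↔ v ∈ ρ ∧ ρ ⊂ σ ∧ IsNonconstantOn e ρ := by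
    intro ρ
    rw [hQ, Finset.mem_filter, hmem, Finset.insert_eq_self]
    refine ⟨fun h => ⟨h.2, h.1.2⟩, fun h => ⟨⟨?_, h.2⟩, h.1⟩⟩
    rintro rfl
    simp at h
  have hsub : ∀ ρ ∈ Q, insert v (ρ.filter fun w => e w ≠ e v) ⊆ ρ := fun ρ hρ =>
    Finset.insert_subset ((hmemQ ρ).1 hρ).1 (Finset.filter_subset _ _)
  have hnc : ∀ ρ : Finset ι, IsNonconstantOn e ρ →
      IsNonconstantOn e (insert v (ρ.filter fun w => e w ≠ e v)) := by
    intro ρ hρ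
    obtain ⟨x, hx, hxv⟩ := hρ.exists_ne (e v)
    exact ⟨x, by simp [hx, hxv], v, by simp, hxv⟩
  refine isAcyclicFamily_chainFamily_of_closure (fun _ _ _ h h' => h'.trans h)
    (fun ρ => σ.card - ρ.card) (fun ρ => insert v (ρ.filter fun w => e w ≠ e v)) _ ?_ ?_ ?_ ?_ ?_ ?_
  · intro x hx y hy h hne
    have h1 : y.card < x.card := Finset.card_lt_card ((show y ⊆ x from h).ssubset_of_ne hne.symm)
    have h2 : x.card ≤ σ.card := Finset.card_le_card ((hmemQ x).1 hx).2.1.1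
    change σ.card - x.card < σ.card - y.card
    omega
  · intro ρ hρ
    obtain ⟨h1, h2, h3⟩ := (hmemQ ρ).1 hρ
    exact (hmemQ _).2 ⟨Finset.mem_insert_self _ _, (hsub ρ hρ).trans_ssubset h2, hnc ρ h3⟩
  · intro ρ _
    ext w
    simp only [Finset.mem_insert, Finset.mem_filter]
    tauto
  · exact hsub
  · intro x _ y _ h
    exact Finset.insert_subset_insert _ (Finset.filter_subset_filter _ h)
  · have hσ : IsNonconstantOn e σ := hτ.mono (Finset.erase_subset _ _)
    refine isAcyclicFamily_chainFamily_of_cone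
      (q := insert v (σ.filter fun w => e w ≠ e v)) ?_ ?_
    · refine Finset.mem_filter.2 ⟨(hmemQ _).2 ⟨Finset.mem_insert_self _ _, ?_, hnc σ hσ⟩, ?_⟩
      · refine (Finset.insert_subset hv (Finset.filter_subset _ _)).ssubset_of_ne fun h => ?_
        -- The candidate largest element is proper in `σ` because it omits a second element with the
        -- value `e v`, which exists as `e` is nonconstant on `σ.erase v`.
        obtain ⟨x, hx, hxv⟩ := hτ.exists_eq (e v)
        have hx' := Finset.mem_of_mem_erase hx
        rw [← h] at hx'
        simp [hxv, Finset.ne_of_mem_erase hx] at hx'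
      · ext w
        simp only [Finset.mem_insert, Finset.mem_filter]
        tauto
    · intro ρ hρ _
      obtain ⟨h1, h2⟩ := Finset.mem_filter.1 hρ
      refine Or.inr ?_
      change ρ ⊆ _
      rw [← h2]
      exact Finset.insert_subset_insert _ (Finset.filter_subset_filter _ ((hmemQ ρ).1 h1).2.1.1)

theorem comparables_eq_nonconstantSSubsets {e : ι → ZMod 2} {Q : Finset (Finset ι)}
    {σ : Finset ι} (hlower : ∀ ρ, ρ ⊂ σ → IsNonconstantOn e ρ → ρ ∈ Q)
    (hQ : ∀ ρ ∈ Q, IsNonconstantOn e ρ) (hmax : ∀ ρ ∈ Q, σ ⊆ ρ → ρ = σ) :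
    comparables (· ⊆ ·) Q σ = nonconstantSSubsets e σ := by
  ext ρ
  rw [mem_comparables, mem_nonconstantSSubsets]
  constructor
  · rintro ⟨h1, h2, h | h⟩
    · exact ⟨h.ssubset_of_ne h2, hQ ρ h1⟩
    · exact absurd (hmax ρ h1 h) h2
  · rintro ⟨h1, h2⟩
    exact ⟨hlower ρ h1 h2, h1.ne, Or.inl h1.1⟩

theorem rankDefect_le_card (L : Finset (Finset ι)) (d : ℤ) :
    rankDefect L d ≤ (cardSlice L d).card := by
  simp only [rankDefect]
  omega

/-- The order complex of the proper nonconstant subsets of a nonconstant set has the homology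
of a sphere. -/
theorem sphere_nonconstantSSubsets {e : ι → ZMod 2} {σ : Finset ι} (hσ : IsNonconstantOn e σ) :
    (∀ d, rankDefect (chainFamily (· ⊆ ·) (nonconstantSSubsets e σ)) d ≤
      if d = σ.card - 2 then 1 else 0) ∧
    signSum (chainFamily (· ⊆ ·) (nonconstantSSubsets e σ)) = (-1) ^ σ.card := by
  induction σ using Finset.strongInduction with
  | H σ ih =>
    have hcard := hσ.two_le_card
    rcases hcard.eq_or_lt with h2 | h3
    -- Two elements: there is no proper nonconstant subset, and the family `{∅}` is the sphere of
    -- dimension -1.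
    · have hempty : nonconstantSSubsets e σ = ∅ := by
        refine Finset.eq_empty_of_forall_notMem fun ρ hρ => ?_
        obtain ⟨h, h'⟩ := mem_nonconstantSSubsets.1 hρ
        have := Finset.card_lt_card h
        have := h'.two_le_card
        omega
      have hchain : chainFamily (· ⊆ ·) (∅ : Finset (Finset ι)) = {∅} := by
        ext s
        simp only [mem_chainFamily, Finset.subset_empty, Finset.mem_singleton,
          and_iff_left_iff_imp]
        rintro rfl
        simp
      rw [hempty, hchain, ← h2]
      refine ⟨fun d => (rankDefect_le_card _ d).trans ?_, by simp [signSum]⟩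
      by_cases hd : d = 0
      · simp [cardSlice, Finset.filter_singleton, hd]
      · simp [cardSlice, Finset.filter_singleton, hd, Ne.symm hd]
    · obtain ⟨x, hx, y, hy, hxy⟩ := hσ
      -- Erasing an element outside `{x, y}` keeps the set nonconstant. Removing the point `σ.erase
      -- v` from the poset leaves an acyclic family, so the homology is that of its link, shifted by
      -- one.
      obtain ⟨v, hv, hv'⟩ := Finset.exists_mem_notMem_of_card_lt_card
        (s := {x, y}) (t := σ) ((Finset.card_le_two).trans_lt h3)
      simp only [Finset.mem_insert, Finset.mem_singleton, not_or] at hv'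
      have hτ : IsNonconstantOn e (σ.erase v) :=
        ⟨x, by simp [hx, Ne.symm hv'.1], y, by simp [hy, Ne.symm hv'.2], hxy⟩
      have hssub := Finset.erase_ssubset hv
      have hacyc := isAcyclicFamily_nonconstantSSubsets_erase hv hτ
      obtain ⟨ih1, ih2⟩ := ih _ hssub hτ
      have hlink : link (chainFamily (· ⊆ ·) (nonconstantSSubsets e σ)) (σ.erase v) =
          chainFamily (· ⊆ ·) (nonconstantSSubsets e (σ.erase v)) := by
        rw [link_chainFamily (mem_nonconstantSSubsets.2 ⟨hssub, hτ⟩),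
          comparables_eq_nonconstantSSubsets
          (fun ρ h h' => mem_nonconstantSSubsets.2 ⟨h.trans hssub, h'⟩)
          (fun ρ h => (mem_nonconstantSSubsets.1 h).2)]
        intro ρ hρ h
        refine (Finset.eq_of_subset_of_card_le h ?_).symm
        have := Finset.card_lt_card (mem_nonconstantSSubsets.1 hρ).1
        rw [Finset.card_erase_of_mem hv]
        omega
      have hc : (σ.erase v).card + 1 = σ.card := Finset.card_erase_add_one hv
      refine ⟨fun d => ?_, ?_⟩
      · have h := rankDefect_le_deletion_add_link
          (chainFamily (· ⊆ ·) (nonconstantSSubsets e σ)) (σ.erase v) d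
        rw [hlink, deletion_chainFamily] at h
        refine h.trans ((add_le_add (hacyc.1 d) (ih1 (d - 1))).trans ?_)
        rw [zero_add]
        split_ifs <;> omega
      · rw [signSum_eq_deletion_sub_link _ (σ.erase v), hlink, deletion_chainFamily, hacyc.2, ih2,
          ← hc, pow_succ]
        ring

/-- The homology of the order complex of a lower set of nonconstant sets is bounded by the number
of these sets, and their signs determine its Euler characteristic. -/
theorem nonempty_chainFamily_bounds {e : ι → ZMod 2} (Q : Finset (Finset ι))
    (hQ : ∀ ρ ∈ Q, IsNonconstantOn e ρ)
    (hlower : ∀ σ ∈ Q, ∀ ρ, ρ ⊂ σ → IsNonconstantOn e ρ → ρ ∈ Q) :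
    (∀ d, rankDefect ((chainFamily (· ⊆ ·) Q).erase ∅) d ≤ (cardSlice Q (d + 1)).card) ∧
    signSum ((chainFamily (· ⊆ ·) Q).erase ∅) = - signSum Q := by
  induction Q using Finset.strongInduction with
  | H Q ih =>
    rcases Q.eq_empty_or_nonempty with rfl | hne
    · have hchain : (chainFamily (· ⊆ ·) (∅ : Finset (Finset ι))).erase ∅ = ∅ := by
        ext s
        simp only [mem_chainFamily, Finset.subset_empty, Finset.mem_erase, Finset.notMem_empty]
        tauto
      rw [hchain]
      exact ⟨fun d => (rankDefect_le_card _ d).trans (by simp [cardSlice]), by simp [signSum]⟩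
    · obtain ⟨p, hp, hmax⟩ := Finset.exists_max_image Q Finset.card hne
      have hdel : deletion ((chainFamily (· ⊆ ·) Q).erase ∅) p =
          (chainFamily (· ⊆ ·) (Q.erase p)).erase ∅ := by
        rw [← deletion_chainFamily]
        ext s
        simp only [mem_deletion, Finset.mem_erase]
        tauto
      have hlink : link ((chainFamily (· ⊆ ·) Q).erase ∅) p =
          chainFamily (· ⊆ ·) (nonconstantSSubsets e p) := by
        rw [← comparables_eq_nonconstantSSubsets (hlower p hp) hQ
          (fun ρ hρ h => (Finset.eq_of_subset_of_card_le h (hmax ρ hρ)).symm),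
          ← link_chainFamily hp]
        ext s
        simp only [mem_link, Finset.mem_erase, Finset.insert_ne_empty, ne_eq, not_false_eq_true,
          true_and]
      obtain ⟨ih1, ih2⟩ := ih _ (Finset.erase_ssubset hp)
        (fun ρ hρ => hQ ρ (Finset.mem_of_mem_erase hρ)) (by
          intro σ hσ ρ h h'
          have hσ' := Finset.mem_of_mem_erase hσ
          refine Finset.mem_erase.2 ⟨?_, hlower σ hσ' ρ h h'⟩
          rintro rfl
          exact absurd (Finset.card_lt_card h) (not_lt.2 (hmax σ hσ')))
      obtain ⟨s1, s2⟩ := sphere_nonconstantSSubsets (hQ p hp)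
      refine ⟨fun d => ?_, ?_⟩
      · have h := rankDefect_le_deletion_add_link ((chainFamily (· ⊆ ·) Q).erase ∅) p d
        rw [hdel, hlink] at h
        refine h.trans ((add_le_add (ih1 d) (s1 (d - 1))).trans (le_of_eq ?_))
        -- The sphere of `p` contributes at `d - 1 = |p| - 2`, which is when `p` is counted in
        -- `cardSlice Q (d + 1)`.
        have : cardSlice Q (d + 1) = if (p.card : ℤ) = d + 1 then
            insert p (cardSlice (Q.erase p) (d + 1)) else cardSlice (Q.erase p) (d + 1) := by
          conv_lhs => rw [cardSlice, ← Finset.insert_erase hp, Finset.filter_insert]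
          rfl
        rw [this]
        by_cases hd : (p.card : ℤ) = d + 1
        · rw [if_pos hd, if_pos (by omega), Finset.card_insert_of_notMem (by simp)]
          push_cast
          rfl
        · rw [if_neg hd, if_neg (by omega), add_zero]
      · rw [signSum_eq_deletion_sub_link _ p, hdel, hlink, ih2, s2]
        simp only [signSum]
        rw [← Finset.sum_erase_add _ _ hp]
        ring

end Nonconstant

end RandomSubcomplex

namespace RandomSubcomplex

/-! ### Simplicial homology in terms of incidence ranks -/

section Bridge

variable {ι : Type*} {K : PreAbstractSimplicialComplex ι}

theorem Simplex.facet_val [DecidableEq ι] {p : ℕ} (τ : Simplex K (p + 1)) (v : {v // v ∈ τ.1}) :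
    (τ.facet v).1 = τ.1.erase v.1 := by
  simp only [Simplex.facet]
  congr!

theorem boundary_single {p : ℕ} (τ : Simplex K (p + 1)) :
    boundary K p (Finsupp.single τ 1) =
      ∑ v ∈ τ.1.attach, Finsupp.single (τ.facet v) (1 : ZMod 2) := by
  simp [boundary]

/-- Exchanging the two removed vertices pairs off equal terms, which cancel modulo 2. -/
theorem boundary_boundary (p : ℕ) (z : Chain K (p + 2)) : boundary K p (boundary K (p + 1) z) = 0 := by
  classical
  suffices h : boundary K p ∘ₗ boundary K (p + 1) = 0 from LinearMap.congr_fun h z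
  refine Finsupp.lhom_ext' fun τ => LinearMap.ext_ring ?_
  change boundary K p (boundary K (p + 1) (Finsupp.single τ 1)) = 0
  rw [boundary_single, map_sum]
  simp only [boundary_single]
  rw [Finset.sum_sigma']
  have hmem : ∀ x : (v : {v // v ∈ τ.1}) × {w // w ∈ (τ.facet v).1},
      x.2.1 ≠ x.1.1 ∧ x.2.1 ∈ τ.1 := fun x =>
    Finset.mem_erase.1 (Simplex.facet_val τ x.1 ▸ x.2.2)
  refine Finset.sum_involution (fun x _ => ⟨⟨x.2.1, (hmem x).2⟩, ⟨x.1.1, by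
    rw [Simplex.facet_val]
    exact Finset.mem_erase.2 ⟨(hmem x).1.symm, x.1.2⟩⟩⟩) ?_ ?_ ?_ ?_
  · intro x _
    have : ∀ a b : Simplex K p, a = b →
        Finsupp.single a (1 : ZMod 2) + Finsupp.single b 1 = 0 := by
      rintro a _ rfl
      rw [← Finsupp.single_add, show (1 : ZMod 2) + 1 = 0 from rfl, Finsupp.single_zero]
    refine this _ _ (Subtype.ext ?_)
    simp only [Simplex.facet_val]
    exact Finset.erase_right_comm
  · intro x _ _ h
    exact (hmem x).1 (congrArg (fun y => y.1.1) h)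
  · intro x _
    simp
  · intro x _
    rfl

theorem boundaries_le_cycles (p : ℕ) : boundaries K p ≤ cycles K p := by
  cases p with
  | zero => exact le_top
  | succ p =>
    rintro _ ⟨z, rfl⟩
    exact boundary_boundary p z

theorem boundary_single_apply [DecidableEq ι] {p : ℕ} (τ : Simplex K (p + 1))
    (s : Simplex K p) :
    boundary K p (Finsupp.single τ 1) s = if s.1 ⊆ τ.1 then 1 else 0 := by
  classical
  rw [boundary_single, Finsupp.finsetSum_apply]
  simp only [Finsupp.single_apply]
  split_ifs with h
  · obtain ⟨v, hv⟩ : ∃ v, τ.1 \ s.1 = {v} := by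
      rw [← Finset.card_eq_one, Finset.card_sdiff_of_subset h, τ.2.2, s.2.2]
      omega
    have hvm : v ∈ τ.1 ∧ v ∉ s.1 := Finset.mem_sdiff.1 (hv ▸ Finset.mem_singleton_self v)
    rw [Finset.sum_eq_single ⟨v, hvm.1⟩]
    · refine if_pos (Subtype.ext ?_)
      rw [Simplex.facet_val, Finset.erase_eq, ← hv, Finset.sdiff_sdiff_eq_self h]
    · intro w _ hw
      refine if_neg fun hs => hw (Subtype.ext ?_)
      rw [← Finset.mem_singleton, ← hv, Finset.mem_sdiff, ← hs, Simplex.facet_val]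
      exact ⟨w.2, by simp⟩
    · intro hn
      exact absurd (Finset.mem_attach _ _) hn
  · refine Finset.sum_eq_zero fun v _ => if_neg fun hs => h ?_
    rw [← hs, Simplex.facet_val]
    exact Finset.erase_subset _ _

variable {F : Finset (Finset ι)}

/-- The `p`-simplices of `K` as the members of its family of faces with `p + 1` elements. -/
def simplexEquiv (hF : ∀ s, s ∈ F ↔ s ∈ K.faces) (p : ℕ) {d : ℤ} (hd : d = p + 1) :
    Simplex K p ≃ cardSlice F d :=
  Equiv.subtypeEquivRight fun s => by
    rw [mem_cardSlice, hF, hd]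
    norm_cast

theorem faceNumber_eq (hF : ∀ s, s ∈ F ↔ s ∈ K.faces) (p : ℕ) :
    faceNumber K p = (cardSlice F (p + 1)).card := by
  rw [faceNumber, Nat.card_congr (simplexEquiv hF p rfl), Nat.card_eq_fintype_card,
    Fintype.card_coe]

theorem finrank_boundaries [DecidableEq ι] (hF : ∀ s, s ∈ F ↔ s ∈ K.faces) (p : ℕ) :
    Module.finrank (ZMod 2) (boundaries K p) = (incidence F (p + 2)).rank := by
  classical
  have : Fintype (Simplex K (p + 1)) := Fintype.ofEquiv _
    (simplexEquiv hF (p + 1) (d := p + 2) (by push_cast; ring)).symm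
  have : Fintype (Simplex K p) := Fintype.ofEquiv _ (simplexEquiv hF p rfl).symm
  have h : LinearMap.toMatrix Finsupp.basisSingleOne Finsupp.basisSingleOne (boundary K p) =
      (incidence F (p + 2)).submatrix (simplexEquiv hF p (by ring))
        (simplexEquiv hF (p + 1) (by push_cast; ring)) := by
    ext s t
    rw [LinearMap.toMatrix_apply, Finsupp.coe_basisSingleOne, Finsupp.basisSingleOne_repr,
      LinearEquiv.refl_apply, boundary_single_apply]
    rfl
  rw [← Matrix.rank_submatrix (incidence F (p + 2)) (simplexEquiv hF p (by ring))
    (simplexEquiv hF (p + 1) (by push_cast; ring)), ← h,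
    Matrix.rank_eq_finrank_range_toLin _ Finsupp.basisSingleOne Finsupp.basisSingleOne,
    Matrix.toLin_toMatrix]
  rfl

/-- The empty set is not a face, so the matrix has no rows. This matches the convention that every
0-chain is a cycle, that is, unreduced homology. -/
theorem rank_incidence_one [DecidableEq ι] (hF : ∀ s, s ∈ F ↔ s ∈ K.faces) :
    (incidence F 1).rank = 0 := by
  have : IsEmpty (cardSlice F (1 - 1)) := by
    refine ⟨fun s => ?_⟩
    obtain ⟨h1, h2⟩ := mem_cardSlice.1 s.2
    have := ((K.isRelLowerSet_faces ((hF _).1 h1)).1).card_pos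
    omega
  exact Nat.le_zero.1 ((Matrix.rank_le_card_height _).trans Fintype.card_eq_zero.le)

theorem finrank_cycles [DecidableEq ι] (hF : ∀ s, s ∈ F ↔ s ∈ K.faces) (p : ℕ) :
    Module.finrank (ZMod 2) (cycles K p) + (incidence F (p + 1)).rank =
      (cardSlice F (p + 1)).card := by
  have (q : ℕ) : Finite (Simplex K q) := Finite.of_equiv _ (simplexEquiv hF q rfl).symm
  have hdim (q : ℕ) : Module.finrank (ZMod 2) (Chain K q) = (cardSlice F (q + 1)).card := by
    have := Fintype.ofFinite (Simplex K q)
    rw [Module.finrank_finsupp_self, ← Nat.card_eq_fintype_card, ← faceNumber_eq hF]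
    rfl
  cases p with
  | zero =>
    have : (incidence F ((0 : ℕ) + 1)).rank = 0 := by
      simpa using rank_incidence_one hF
    rw [this, add_zero, ← hdim]
    exact finrank_top _ _
  | succ p =>
    have h := (boundary K p).finrank_range_add_finrank_ker
    have h' := finrank_boundaries hF p
    have h'' : (incidence F ((p + 1 : ℕ) + 1)).rank = (incidence F (p + 2)).rank := by
      rw [show (((p + 1 : ℕ) : ℤ) + 1) = p + 2 by push_cast; ring]
    rw [h'', ← h', ← hdim, ← h, add_comm]
    rfl

theorem betti_eq_rankDefect [DecidableEq ι] (hF : ∀ s, s ∈ F ↔ s ∈ K.faces) (p : ℕ) :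
    (betti K p : ℤ) = rankDefect F (p + 1) := by
  have (q : ℕ) : Finite (Simplex K q) := Finite.of_equiv _ (simplexEquiv hF q rfl).symm
  have h1 := ((boundaries K p).submoduleOf (cycles K p)).finrank_quotient_add_finrank
  have h2 := (Submodule.submoduleOfEquivOfLe (boundaries_le_cycles (K := K) p)).finrank_eq
  have h3 := finrank_boundaries hF p
  have h4 := finrank_cycles hF p
  have h5 : (incidence F ((p : ℤ) + 1 + 1)).rank = (incidence F (p + 2)).rank := by
    rw [show (p : ℤ) + 1 + 1 = p + 2 by ring]
  have h6 : betti K p = Module.finrank (ZMod 2)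
    (cycles K p ⧸ (boundaries K p).submoduleOf (cycles K p)) := rfl
  simp only [rankDefect]
  omega

theorem cardSlice_eq_empty {N : ℕ} (hN : ∀ s ∈ F, s.card ≤ N) {d : ℤ} (hd : N < d) :
    cardSlice F d = ∅ := by
  refine Finset.eq_empty_of_forall_notMem fun s hs => ?_
  obtain ⟨h1, h2⟩ := mem_cardSlice.1 hs
  have := hN s h1
  omega

theorem rank_incidence_eq_zero [DecidableEq ι] {N : ℕ} (hN : ∀ s ∈ F, s.card ≤ N) {d : ℤ}
    (hd : N < d) : (incidence F d).rank = 0 := by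
  have h := (incidence F d).rank_le_card_width
  simpa [cardSlice_eq_empty hN hd] using h

theorem sum_card_eq_sum_range (hF : ∀ s, s ∈ F ↔ s ∈ K.faces) {N : ℕ}
    (hN : ∀ s ∈ F, s.card ≤ N) {R : Type*} [CommSemiring R] (g : ℕ → R) :
    ∑ s ∈ F, g s.card = ∑ i ∈ Finset.range N, g (i + 1) * ((cardSlice F (i + 1)).card : R) := by
  have hpos : ∀ s ∈ F, 0 < s.card := fun s hs =>
    ((K.isRelLowerSet_faces ((hF _).1 hs)).1).card_pos
  rw [← Finset.sum_fiberwise_of_maps_to (g := fun s => s.card - 1) (t := Finset.range N)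
    fun s hs => Finset.mem_range.2 (by have := hN s hs; have := hpos s hs; omega)]
  refine Finset.sum_congr rfl fun i _ => ?_
  have h : F.filter (fun s => s.card - 1 = i) = cardSlice F (i + 1) :=
    Finset.filter_congr fun s hs => by have := hpos s hs; omega
  rw [h, Finset.sum_congr rfl fun s hs => by
    rw [show s.card = i + 1 by have := (mem_cardSlice.1 hs).2; omega], Finset.sum_const,
    nsmul_eq_mul, mul_comm]

/-- The Euler–Poincaré formula. -/
theorem eulerChar_eq_neg_signSum (hF : ∀ s, s ∈ F ↔ s ∈ K.faces) : eulerChar K = - signSum F := by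
  classical
  set N := F.sup Finset.card with hN'
  have hN : ∀ s ∈ F, s.card ≤ N := fun s hs => Finset.le_sup (f := Finset.card) hs
  rw [signSum, sum_card_eq_sum_range hF hN, ← Finset.sum_neg_distrib, eulerChar,
    finsum_eq_sum_of_support_subset (s := Finset.range N)]
  -- In the alternating sum the ranks telescope, leaving only the last one, which vanishes above the
  -- top dimension.
  · have key : ∀ M : ℕ, ∑ i ∈ Finset.range M, (-1 : ℤ) ^ i * (betti K i : ℤ) =
        ∑ i ∈ Finset.range M, (-1) ^ i * ((cardSlice F (i + 1)).card : ℤ) +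
          (-1) ^ M * ((incidence F (M + 1)).rank : ℤ) := by
      intro M
      induction M with
      | zero =>
        have := rank_incidence_one hF
        simp [this]
      | succ M ih =>
        rw [Finset.sum_range_succ, Finset.sum_range_succ, ih, betti_eq_rankDefect hF, rankDefect]
        push_cast
        ring
    rw [key, rank_incidence_eq_zero hN (by omega)]
    simp [pow_succ]
  · intro i hi
    by_contra h
    have hNi : (N : ℤ) < i + 1 := by
      simp only [Finset.coe_range, Set.mem_Iio, not_lt] at h
      omega
    refine hi ?_
    have hb : (betti K i : ℤ) ≤ 0 := by
      have := congrArg Finset.card (cardSlice_eq_empty hN hNi)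
      rw [Finset.card_empty] at this
      rw [betti_eq_rankDefect hF, rankDefect]
      omega
    change (-1 : ℤ) ^ i * (betti K i : ℤ) = 0
    rw [le_antisymm hb (Int.natCast_nonneg _), mul_zero]

end Bridge

end RandomSubcomplex

namespace RandomSubcomplex

/-! ### The dual subcomplex as an order complex -/

section DualSubcomplex

variable {ι : Type*} {K : PreAbstractSimplicialComplex ι}

open Classical in
/-- The value of a `0`-cochain on a vertex, extended by zero to the elements of `ι` which are not
vertices of `K`. -/
noncomputable def vertexValue (ε : Cochain K 0) (x : ι) : ZMod 2 :=
  if h : {x} ∈ K.faces then ε ⟨{x}, h, Finset.card_singleton x⟩ else 0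

theorem singleton_mem_faces {σ : Finset ι} (hσ : σ ∈ K.faces) {x : ι} (hx : x ∈ σ) :
    {x} ∈ K.faces :=
  (K.isRelLowerSet_faces hσ).2 (Finset.singleton_subset_iff.2 hx) (Finset.singleton_nonempty x)

theorem vertexValue_of_mem (ε : Cochain K 0) {σ : Finset ι} (hσ : σ ∈ K.faces) {x : ι}
    (hx : x ∈ σ) :
    vertexValue ε x = ε ⟨{x}, singleton_mem_faces hσ hx, Finset.card_singleton x⟩ :=
  dif_pos (singleton_mem_faces hσ hx)

theorem cochain_eq_sum_vertexValue (ε : Cochain K 0) (ρ : Simplex K 0) :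
    ε ρ = ∑ x ∈ ρ.1, vertexValue ε x := by
  obtain ⟨ρ, hρ, hcard⟩ := ρ
  obtain ⟨x, rfl⟩ := Finset.card_eq_one.1 hcard
  rw [Finset.sum_singleton, vertexValue_of_mem ε hρ (Finset.mem_singleton_self x)]

theorem coboundary_ne_zero_iff (ε : Cochain K 0) (σ : Simplex K 1) :
    coboundary ε σ ≠ 0 ↔ IsNonconstantOn (vertexValue ε) σ.1 := by
  classical
  obtain ⟨x, y, hxy, hσ⟩ := Finset.card_eq_two.1 σ.2.2
  have h : coboundary ε σ = vertexValue ε y + vertexValue ε x := by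
    have hf : ∀ v : {v // v ∈ σ.1}, ε (σ.facet v) =
        (fun w => ∑ u ∈ σ.1.erase w, vertexValue ε u) v.1 := fun v => by
      rw [cochain_eq_sum_vertexValue ε (σ.facet v), Simplex.facet_val]
    rw [coboundary, Finset.sum_congr rfl fun v _ => hf v,
      Finset.sum_attach σ.1 fun w => ∑ u ∈ σ.1.erase w, vertexValue ε u, hσ,
      Finset.sum_pair hxy, Finset.erase_insert (by simpa using hxy), Finset.pair_comm,
      Finset.erase_insert (by simpa using hxy.symm), Finset.sum_singleton, Finset.sum_singleton]
  have key : ∀ a b : ZMod 2, b + a ≠ 0 ↔ a ≠ b := by decide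
  rw [h, key]
  refine ⟨fun hne => ⟨x, by simp [hσ], y, by simp [hσ], hne⟩, ?_⟩
  rintro ⟨a, ha, b, hb, hab⟩
  rw [hσ, Finset.mem_insert, Finset.mem_singleton] at ha hb
  rcases ha with rfl | rfl <;> rcases hb with rfl | rfl
  exacts [absurd rfl hab, hab, hab.symm, absurd rfl hab]

theorem exists_subset_of_isChain {α : Type*} (s : Finset (Finset α)) (hs : s.Nonempty)
    (h : IsChain (· ⊆ ·) (s : Set (Finset α))) : ∃ m ∈ s, ∀ σ ∈ s, m ⊆ σ := by
  obtain ⟨m, hm, hmin⟩ := Finset.exists_min_image s Finset.card hs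
  refine ⟨m, hm, fun σ hσ => ?_⟩
  rcases h.total hm hσ with h' | h'
  · exact h'
  · exact (Finset.eq_of_subset_of_card_le h' (hmin σ hσ)).ge

/-- The simplices of the dual subcomplex are the nonempty chains of faces on which the cochain is
not constant. -/
theorem mem_faces_dualSubcomplex_iff (ε : Cochain K 0) (s : Finset (Finset ι)) :
    s ∈ (dualSubcomplex ε).faces ↔ s.Nonempty ∧
      (∀ σ ∈ s, σ ∈ K.faces ∧ IsNonconstantOn (vertexValue ε) σ) ∧
      IsChain (· ⊆ ·) (s : Set (Finset ι)) := by
  classical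
  constructor
  · rintro ⟨hne, c, hc, hsc, σ₀, hσ₀, hmin, hd⟩
    exact ⟨hne, fun σ hσ => ⟨hc.2.1 σ (hsc hσ),
      ((coboundary_ne_zero_iff ε σ₀).1 hd).mono (hmin σ (hsc hσ))⟩, hc.2.2.mono hsc⟩
  · rintro ⟨hne, hs, hchain⟩
    obtain ⟨m, hm, hmin⟩ := exists_subset_of_isChain s hne hchain
    obtain ⟨hmK, x, hx, y, hy, hxy⟩ := hs m hm
    -- The smallest member of the chain contains an edge on which the cochain takes two values;
    -- adjoining that edge at the bottom gives the simplex of `Sd(K)` required by the definition.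
    have hsub : {x, y} ⊆ m := by
      simp [Finset.insert_subset_iff, hx, hy]
    have hpair : {x, y} ∈ K.faces :=
      (K.isRelLowerSet_faces hmK).2 hsub (Finset.insert_nonempty x {y})
    have hcard : ({x, y} : Finset ι).card = 0 + 1 + 1 :=
      Finset.card_pair fun h => hxy (congrArg _ h)
    refine ⟨hne, insert {x, y} s, ⟨Finset.insert_nonempty _ _, ?_, ?_⟩, Finset.subset_insert _ _,
      ⟨{x, y}, hpair, hcard⟩, Finset.mem_insert_self _ _, ?_, ?_⟩
    · intro σ hσ
      rcases Finset.mem_insert.1 hσ with rfl | hσ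
      exacts [hpair, (hs σ hσ).1]
    · rw [Finset.coe_insert]
      exact hchain.insert fun σ hσ _ => Or.inl (hsub.trans (hmin σ hσ))
    · intro σ hσ
      rcases Finset.mem_insert.1 hσ with rfl | hσ
      exacts [subset_rfl, hsub.trans (hmin σ hσ)]
    · exact (coboundary_ne_zero_iff ε _).2 ⟨x, by simp, y, by simp, hxy⟩

variable {F : Finset (Finset ι)}

open Classical in
/-- The members of `F` on which the cochain is not constant. -/
noncomputable def nonconstantFaces (F : Finset (Finset ι)) (ε : Cochain K 0) :
    Finset (Finset ι) :=
  F.filter fun σ => IsNonconstantOn (vertexValue ε) σ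

theorem mem_nonconstantFaces {ε : Cochain K 0} {σ : Finset ι} :
    σ ∈ nonconstantFaces F ε ↔ σ ∈ F ∧ IsNonconstantOn (vertexValue ε) σ := by
  simp [nonconstantFaces]

theorem dualSubcomplex_bounds (hF : ∀ s, s ∈ F ↔ s ∈ K.faces) (ε : Cochain K 0) :
    (∀ i : ℕ, betti (dualSubcomplex ε) i ≤
      (cardSlice (nonconstantFaces F ε) ((i + 1 : ℕ) + 1)).card) ∧
    eulerChar (dualSubcomplex ε) = signSum (nonconstantFaces F ε) := by
  classical
  have hV : ∀ s, s ∈ (chainFamily (· ⊆ ·) (nonconstantFaces F ε)).erase ∅ ↔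
      s ∈ (dualSubcomplex ε).faces := by
    intro s
    rw [mem_faces_dualSubcomplex_iff, Finset.mem_erase, mem_chainFamily,
      Finset.nonempty_iff_ne_empty, Finset.subset_iff]
    simp only [mem_nonconstantFaces, hF]
  obtain ⟨h1, h2⟩ := nonempty_chainFamily_bounds (e := vertexValue ε) (nonconstantFaces F ε)
    (fun ρ hρ => (mem_nonconstantFaces.1 hρ).2) (by
      intro σ hσ ρ hρσ hρ
      refine mem_nonconstantFaces.2 ⟨(hF _).2 ?_, hρ⟩
      exact (K.isRelLowerSet_faces ((hF _).1 (mem_nonconstantFaces.1 hσ).1)).2 hρσ.1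
        (Finset.card_pos.1 (by have := hρ.two_le_card; omega)))
  refine ⟨fun i => ?_, ?_⟩
  -- An `i`-simplex of the order complex is a chain of `i + 1` faces, so the bound is used at `d = i
  -- + 1` and counts faces with `i + 2` vertices.
  · have := betti_eq_rankDefect hV i
    have h3 := h1 (i + 1)
    rw [← this] at h3
    exact_mod_cast h3
  · rw [eulerChar_eq_neg_signSum hV, h2, neg_neg]

end DualSubcomplex

/-! ### Expectations under the product measure -/

section Probability

variable {ι : Type*} {K : PreAbstractSimplicialComplex ι}

theorem isProbabilityMeasure_bernoulliLaw {ν : ℝ} (hν : ν ∈ Set.Icc (0 : ℝ) 1) :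
    IsProbabilityMeasure (bernoulliLaw ν) := by
  refine ⟨?_⟩
  have h : (0 : ℝ) ≤ 1 - ν := sub_nonneg.2 hν.2
  simp [bernoulliLaw, ← ENNReal.ofReal_add hν.1 h]

theorem isProbabilityMeasure_cochainLaw [Finite K.faces] (p : ℕ) {ν : ℝ}
    (hν : ν ∈ Set.Icc (0 : ℝ) 1) : IsProbabilityMeasure (cochainLaw K p ν) := by
  have := isProbabilityMeasure_bernoulliLaw hν
  unfold cochainLaw
  infer_instance

theorem bernoulliLaw_zero (ν : ℝ) : bernoulliLaw ν {0} = ENNReal.ofReal ν := by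
  simp [bernoulliLaw]

theorem bernoulliLaw_one (ν : ℝ) : bernoulliLaw ν {1} = ENNReal.ofReal (1 - ν) := by
  simp [bernoulliLaw]

/-- The event is a cylinder: each vertex of `σ` contributes a factor `bernoulliLaw ν {c}`, and all
other vertices contribute 1. -/
theorem cochainLaw_constant [Finite K.faces] {ν : ℝ} (hν : ν ∈ Set.Icc (0 : ℝ) 1)
    {σ : Finset ι} (hσ : σ ∈ K.faces) (c : ZMod 2) :
    cochainLaw K 0 ν {ε | ∀ x ∈ σ, vertexValue ε x = c} = bernoulliLaw ν {c} ^ σ.card := by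
  classical
  have := isProbabilityMeasure_bernoulliLaw hν
  let : Fintype (Simplex K 0) := Fintype.ofFinite _
  have hset : {ε : Cochain K 0 | ∀ x ∈ σ, vertexValue ε x = c} =
      Set.univ.pi fun ρ : Simplex K 0 => if ρ.1 ⊆ σ then {c} else Set.univ := by
    ext ε
    simp only [Set.mem_ofPred_eq, Set.mem_univ_pi]
    constructor
    · rintro h ⟨ρ, hρ, hcard⟩
      obtain ⟨x, rfl⟩ := Finset.card_eq_one.1 hcard
      split_ifs with hx
      · have hx' := Finset.singleton_subset_iff.1 hx
        rw [Set.mem_singleton_iff, ← h x hx', vertexValue_of_mem ε hσ hx']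
      · exact Set.mem_univ _
    · intro h x hx
      have := h ⟨{x}, singleton_mem_faces hσ hx, Finset.card_singleton x⟩
      rw [if_pos (Finset.singleton_subset_iff.2 hx)] at this
      rw [vertexValue_of_mem ε hσ hx]
      exact this
  have hcard : (Finset.univ.filter fun ρ : Simplex K 0 => ρ.1 ⊆ σ).card = σ.card := by
    refine (Finset.card_bij (fun x hx => ⟨{x}, singleton_mem_faces hσ hx,
      Finset.card_singleton x⟩) ?_ ?_ ?_).symm
    · intro x hx
      exact Finset.mem_filter.2 ⟨Finset.mem_univ _, Finset.singleton_subset_iff.2 hx⟩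
    · intro x _ y _ h
      exact Finset.singleton_injective (congrArg Subtype.val h)
    · rintro ⟨ρ, hρ, hcard⟩ h
      obtain ⟨x, rfl⟩ := Finset.card_eq_one.1 hcard
      exact ⟨x, Finset.singleton_subset_iff.1 (Finset.mem_filter.1 h).2, rfl⟩
  rw [hset, cochainLaw, Measure.pi_pi]
  simp only [apply_ite, measure_univ]
  rw [Finset.prod_ite, Finset.prod_const, hcard, Finset.prod_const_one, mul_one]

/-- The probability that a random cochain is not constant on a given face. -/
theorem cochainLaw_real_nonconstant [Finite K.faces] {ν : ℝ} (hν : ν ∈ Set.Icc (0 : ℝ) 1)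
    {σ : Finset ι} (hσ : σ ∈ K.faces) :
    (cochainLaw K 0 ν).real {ε | IsNonconstantOn (vertexValue ε) σ} =
      1 - ν ^ σ.card - (1 - ν) ^ σ.card := by
  have := isProbabilityMeasure_cochainLaw (K := K) 0 hν
  obtain ⟨z, hz⟩ := (K.isRelLowerSet_faces hσ).1
  have hset : {ε : Cochain K 0 | IsNonconstantOn (vertexValue ε) σ} =
      ({ε | ∀ x ∈ σ, vertexValue ε x = 0} ∪ {ε | ∀ x ∈ σ, vertexValue ε x = 1})ᶜ := by
    ext ε
    have key : ∀ a : ZMod 2, a = 0 ∨ a = 1 := by decide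
    simp only [Set.mem_ofPred_eq, Set.mem_compl_iff, Set.mem_union, not_or]
    constructor
    · rintro ⟨x, hx, y, hy, hxy⟩
      exact ⟨fun h => hxy ((h x hx).trans (h y hy).symm),
        fun h => hxy ((h x hx).trans (h y hy).symm)⟩
    · rintro ⟨h0, h1⟩
      push Not at h0 h1
      obtain ⟨x, hx, hx0⟩ := h0
      obtain ⟨y, hy, hy1⟩ := h1
      refine ⟨x, hx, y, hy, ?_⟩
      rw [(key _).resolve_left hx0, (key _).resolve_right hy1]
      decide
  have hdisj : Disjoint {ε : Cochain K 0 | ∀ x ∈ σ, vertexValue ε x = 0}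
      {ε | ∀ x ∈ σ, vertexValue ε x = 1} := by
    rw [Set.disjoint_left]
    intro ε h0 h1
    have := (h0 z hz).symm.trans (h1 z hz)
    exact absurd this (by decide)
  have hmeas : ∀ A : Set (Cochain K 0), MeasurableSet A := fun A => A.toFinite.measurableSet
  rw [hset, probReal_compl_eq_one_sub (hmeas _), measureReal_union hdisj (hmeas _), Measure.real,
    Measure.real, cochainLaw_constant hν hσ, cochainLaw_constant hν hσ, bernoulliLaw_zero,
    bernoulliLaw_one, ENNReal.toReal_pow, ENNReal.toReal_pow, ENNReal.toReal_ofReal hν.1,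
    ENNReal.toReal_ofReal (sub_nonneg.2 hν.2)]
  ring

-- The weight `g` is 1 for the Betti numbers and the sign `(-1) ^ |σ|` for the Euler characteristic.
open Classical in
theorem integral_sum_nonconstant [Finite K.faces] {ν : ℝ} (hν : ν ∈ Set.Icc (0 : ℝ) 1)
    (G : Finset (Finset ι)) (hG : ∀ σ ∈ G, σ ∈ K.faces) (g : Finset ι → ℝ) :
    ∫ ε : Cochain K 0, (∑ σ ∈ G, if IsNonconstantOn (vertexValue ε) σ then g σ else 0)
      ∂(cochainLaw K 0 ν) = ∑ σ ∈ G, (1 - ν ^ σ.card - (1 - ν) ^ σ.card) * g σ := by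
  have := isProbabilityMeasure_cochainLaw (K := K) 0 hν
  rw [integral_finsetSum _ fun σ _ => Integrable.of_finite]
  refine Finset.sum_congr rfl fun σ hσ => ?_
  have h := integral_indicator_const (μ := cochainLaw K 0 ν) (g σ)
    (s := {ε : Cochain K 0 | IsNonconstantOn (vertexValue ε) σ}) (Set.toFinite _).measurableSet
  rw [cochainLaw_real_nonconstant hν (hG σ hσ), smul_eq_mul] at h
  rw [← h]
  rfl

theorem expectedBetti_le [Finite K.faces] {ν : ℝ} (hν : ν ∈ Set.Icc (0 : ℝ) 1) (i : ℕ) :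
    expectedBetti K 0 ν i ≤
      (faceNumber K (i + 1) : ℝ) * (1 - ν ^ (i + 2) - (1 - ν) ^ (i + 2)) := by
  classical
  have := isProbabilityMeasure_cochainLaw (K := K) 0 hν
  set F := (Set.toFinite K.faces).toFinset
  have hF : ∀ s, s ∈ F ↔ s ∈ K.faces := fun s => Set.Finite.mem_toFinset _
  have h := integral_sum_nonconstant hν (cardSlice F ((i + 1 : ℕ) + 1))
    (fun σ hσ => (hF σ).1 (mem_cardSlice.1 hσ).1) fun _ => 1
  have hsum : ∑ σ ∈ cardSlice F ((i + 1 : ℕ) + 1), (1 - ν ^ σ.card - (1 - ν) ^ σ.card) * 1 =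
      (faceNumber K (i + 1) : ℝ) * (1 - ν ^ (i + 2) - (1 - ν) ^ (i + 2)) := by
    rw [faceNumber_eq hF, ← nsmul_eq_mul]
    refine Finset.sum_eq_card_nsmul fun σ hσ => ?_
    rw [show σ.card = i + 2 by have := (mem_cardSlice.1 hσ).2; omega, mul_one]
  rw [← hsum, ← h, expectedBetti]
  refine integral_mono Integrable.of_finite Integrable.of_finite fun ε => ?_
  have hb := (dualSubcomplex_bounds hF ε).1 i
  have hc : cardSlice (nonconstantFaces F ε) ((i + 1 : ℕ) + 1) =
      (cardSlice F ((i + 1 : ℕ) + 1)).filter fun σ => IsNonconstantOn (vertexValue ε) σ := by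
    rw [cardSlice, cardSlice, nonconstantFaces, Finset.filter_comm]
  rw [hc, Finset.card_filter] at hb
  have hb' := Nat.cast_le (α := ℝ).2 hb
  push_cast at hb'
  exact hb'

theorem expectedEulerChar_add [Finite K.faces] {ν : ℝ} (hν : ν ∈ Set.Icc (0 : ℝ) 1) {n : ℕ}
    (hn : ∀ σ ∈ K.faces, σ.card ≤ n + 1) :
    expectedEulerChar K 0 ν + (eulerChar K : ℝ) =
      ∑ i ∈ Finset.range (n + 1), (-1 : ℝ) ^ i * (ν ^ (i + 1) + (1 - ν) ^ (i + 1)) *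
        (faceNumber K i : ℝ) := by
  classical
  set F := (Set.toFinite K.faces).toFinset
  have hF : ∀ s, s ∈ F ↔ s ∈ K.faces := fun s => Set.Finite.mem_toFinset _
  have h := integral_sum_nonconstant hν F (fun σ => (hF σ).1) fun σ => (-1) ^ σ.card
  have hE : expectedEulerChar K 0 ν = ∑ σ ∈ F, (1 - ν ^ σ.card - (1 - ν) ^ σ.card) *
      (-1) ^ σ.card := by
    rw [← h, expectedEulerChar]
    congr 1
    ext ε
    rw [(dualSubcomplex_bounds hF ε).2, signSum, nonconstantFaces, Finset.sum_filter]
    push_cast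
    rfl
  -- A face with `k` vertices contributes `(-1)^k (1 - ν^k - (1 - ν)^k)` to the expectation and
  -- `-(-1)^k` to `χ(K)`; the sum of the two is the weight used here.
  have hsum := sum_card_eq_sum_range hF (N := n + 1) (fun s hs => hn s ((hF s).1 hs))
    fun k => -(-1 : ℝ) ^ k * (ν ^ k + (1 - ν) ^ k)
  rw [hE, eulerChar_eq_neg_signSum hF, signSum]
  push_cast
  rw [← Finset.sum_neg_distrib, ← Finset.sum_add_distrib]
  refine Eq.trans (Finset.sum_congr rfl fun σ _ => by ring) (hsum.trans ?_)
  refine Finset.sum_congr rfl fun i _ => ?_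
  rw [faceNumber_eq hF, pow_succ (-1 : ℝ) i]
  ring

end Probability

end RandomSubcomplex

theorem mainTheorem2 {ι : Type*} (K : PreAbstractSimplicialComplex ι) [Finite K.faces]
    (n : ℕ) (hn : RandomSubcomplex.HasDimension K n) (ν : ℝ) (hν : ν ∈ Set.Icc (0 : ℝ) 1) :
    (∀ i : ℕ, i < n →
      RandomSubcomplex.expectedBetti K 0 ν i ≤
        (RandomSubcomplex.faceNumber K (i + 1) : ℝ) *
          (1 - ν ^ (i + 2) - (1 - ν) ^ (i + 2))) ∧
    RandomSubcomplex.expectedEulerChar K 0 ν + (RandomSubcomplex.eulerChar K : ℝ) =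
      ∑ i ∈ Finset.range (n + 1),
        (-1 : ℝ) ^ i * (ν ^ (i + 1) + (1 - ν) ^ (i + 1)) *
          (RandomSubcomplex.faceNumber K i : ℝ) :=
  ⟨fun i _ => RandomSubcomplex.expectedBetti_le hν i,
    RandomSubcomplex.expectedEulerChar_add hν hn.2⟩
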